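/- **Theorem (ascending optimal policy correspondence).** Let $S\subseteq\mathbb{R}^n$ and $A\subseteq\mathbb{R}^k$ be Borel sets that are lattices under the componentwise order, with $x\vee y$ and $x\wedge y$ the componentwise maximum and minimum; $S\times A$ carries the product order and the product topology. Consider the infinite-horizon discounted dynamic programming model with state space $S$, action space $A$, feasible-action correspondence $\Gamma:S\to 2^A$, transition probability function $p(s,a,\cdot)$ (a Borel-measurable Markov kernel from $S\times A$ to $S$), measurable payoff $r:S\times A\to\mathbb{R}$ and discount factor $\beta\in(0,1)$. A strategy $\sigma=(\sigma_t)_{t\ge1}$ is a sequence of Borel functions $\sigma_t$ from histories $(s(1),a(1),\dots,s(t))\in S\times(A\times S)^{t-1}$ to $A$ with $\sigma_t(s(1),a(1),\dots,s(t))\in\Gamma(s(t))$ at every history. The value function is $$V(s)=\sup_\sigma \mathbb{E}_\sigma\Big[\sum_{t=1}^\infty \beta^{t-1} r(s(t),a(t))\Big],\qquad s(1)=s,$$ where $\mathbb{E}_\sigma$ is the expectation under the law of the process $(s(t),a(t))_{t\ge1}$ induced by $s$, $\sigma$ and $p$. Assume that: * $r$ is bounded and upper semi-continuous; * $p$ is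 upper semi-continuous, i.e. $(s,a)\mapsto\int f(s')\,p(s,a,ds')$ is bounded and upper semi-continuous whenever $f:S\to\mathbb{R}$ is; * $\Gamma$ is upper semi-continuous, i.e. $\{s:\Gamma(s)\subseteq U\}$ is open for every open $U\subseteq A$, and each $\Gamma(s)$ is nonempty and compact. Suppose further that: * $r$ is supermodular on $S\times A$, i.e. $r(x)+r(x')\le r(x\vee x')+r(x\wedge x')$ for all $x,x'\in S\times A$; * $p$ is supermodular, i.e. $(s,a)\mapsto\int f(s')\,p(s,a,ds')$ is supermodular on $S\times A$ for every bounded measurable supermodular $f:S\to\mathbb{R}$; * $\Gamma$ is supermodular, i.e. $a'\in\Gamma(s')$ and $a''\in\Gamma(s'')$ imply $a'\vee a''\in\Gamma(s'\vee s'')$ and $a'\wedge a''\in\Gamma(s'\wedge s'')$. Then the correspondence of optimal solutions $$G(s)=\operatorname{argmax}_{a\in\Gamma(s)}\; r(s,a)+\beta\int V(s')\,p(s,a,ds')$$ is ascending: each $G(s)$ is a nonempty sublattice of $A$, and whenever $s_1\le s_2$, $a_2\in G(s_2)$ and $a_1\in G(s_1)$, we have $a_2\vee a_1\in G(s_2)$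 and $a_2\wedge a_1\in G(s_1)$. -/

import Mathlib

/-- A function `f` on a lattice is supermodular if
`f x + f y ≤ f (x ⊔ y) + f (x ⊓ y)` for all `x`, `y`. -/
def IsSupermodular {X : Type*} [Lattice X] (f : X → ℝ) : Prop :=
  ∀ x y, f x + f y ≤ f (x ⊔ y) + f (x ⊓ y)

/-- A correspondence `Γ` between lattices is supermodular if its graph is closed under
the componentwise join and meet. -/
def IsSupermodularCorr {X Y : Type*} [Lattice X] [Lattice Y] (Γ : X → Set Y) : Prop :=
  ∀ s' s'' a' a'', a' ∈ Γ s' → a'' ∈ Γ s'' →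
    a' ⊔ a'' ∈ Γ (s' ⊔ s'') ∧ a' ⊓ a'' ∈ Γ (s' ⊓ s'')

/-- The (Veinott) strong set order: `StrongSetGE D E` says that `D` is above `E`, i.e. for all
`x ∈ D` and `x' ∈ E`, `x ⊔ x' ∈ D` and `x ⊓ x' ∈ E`. -/
def StrongSetGE {Y : Type*} [Lattice Y] (D E : Set Y) : Prop :=
  ∀ x ∈ D, ∀ x' ∈ E, x ⊔ x' ∈ D ∧ x ⊓ x' ∈ E

/-- A correspondence into a lattice is ascending if its values are nonempty sublattices, and they
increase in the strong set order. -/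
def IsAscending {X Y : Type*} [Preorder X] [Lattice Y] (G : X → Set Y) : Prop :=
  (∀ x, (G x).Nonempty) ∧
  (∀ x, SupClosed (G x) ∧ InfClosed (G x)) ∧
  ∀ x₁ x₂, x₁ ≤ x₂ → StrongSetGE (G x₂) (G x₁)

/-- An infinite-horizon discounted dynamic programming model with state space `S` and
action space `A`. -/
structure DiscountedDP (S A : Type*) [MeasurableSpace S] [MeasurableSpace A] where
  /-- the correspondence of feasible actions -/
  Γ : S → Set A
  /-- the transition probability function -/
  p : ProbabilityTheory.Kernel (S × A) S
  /-- the single-period payoff -/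
  r : S × A → ℝ
  /-- the discount factor -/
  β : ℝ
  measurableSet_Γ : ∀ s, MeasurableSet (Γ s)
  isMarkov_p : ProbabilityTheory.IsMarkovKernel p
  measurable_r : Measurable r
  β_pos : 0 < β
  β_lt_one : β < 1

namespace DiscountedDP

section Strategies

variable {S A : Type*} [MeasurableSpace S] [MeasurableSpace A]

attribute [instance] DiscountedDP.isMarkov_p

/-- Histories up to period `t` (periods are numbered `0, 1, 2, …`): the state-action pairs of the
periods before `t`, together with the state in period `t`. -/
abbrev History (S A : Type*) (t : ℕ) : Type _ := (Fin t → S × A) × S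

/-- A strategy: a sequence of measurable decision rules, each selecting a feasible action at every
history. -/
structure Strategy (M : DiscountedDP S A) where
  act : (t : ℕ) → History S A t → A
  measurable_act : ∀ t, Measurable (act t)
  feasible : ∀ t (h : History S A t), act t h ∈ M.Γ h.2

/-- Given the state-action pairs of the periods `0, …, t` and the state in period `t + 1`, the
history up to period `t + 1`. -/
def nextHistory (t : ℕ) (y : (Finset.Iic t → S × A) × S) : History S A (t + 1) :=
  (fun i => y.1 ⟨i, Finset.mem_Iic.2 (Nat.lt_succ_iff.1 i.2)⟩, y.2)

theorem measurable_nextHistory (t : ℕ) : Measurable (nextHistory (S := S) (A := A) t) := by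
  unfold nextHistory
  fun_prop

/-- The conditional law of the state-action pair of period `t + 1` given those of the periods
`0, …, t`: the new state is drawn from `p` at the last state-action pair, and the new action is
the one prescribed by the strategy. -/
noncomputable def stepKernel (M : DiscountedDP S A) (σ : M.Strategy) (t : ℕ) :
    ProbabilityTheory.Kernel (Finset.Iic t → S × A) (S × A) :=
  (ProbabilityTheory.Kernel.id.prod
      (M.p.comap (fun h : Finset.Iic t → S × A => h ⟨t, Finset.mem_Iic.2 le_rfl⟩)
        (measurable_pi_apply _))).map
    (fun y => (y.2, σ.act (t + 1) (nextHistory t y)))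

theorem measurable_step (M : DiscountedDP S A) (σ : M.Strategy) (t : ℕ) :
    Measurable (fun y : (Finset.Iic t → S × A) × S =>
      (y.2, σ.act (t + 1) (nextHistory t y))) :=
  measurable_snd.prodMk ((σ.measurable_act _).comp (measurable_nextHistory t))

instance (M : DiscountedDP S A) (σ : M.Strategy) (t : ℕ) :
    ProbabilityTheory.IsMarkovKernel (M.stepKernel σ t) :=
  ProbabilityTheory.Kernel.IsMarkovKernel.map _ (M.measurable_step σ t)

/-- The law of the infinite sequence of state-action pairs induced by the initial state `s`, the
strategy `σ` and the transition probabilities (given by the Ionescu-Tulcea theorem). -/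
noncomputable def pathLaw (M : DiscountedDP S A) (σ : M.Strategy) (s : S) :
    MeasureTheory.Measure (ℕ → S × A) :=
  ProbabilityTheory.Kernel.traj (X := fun _ => S × A) (M.stepKernel σ) 0
    (fun _ => (s, σ.act 0 (Fin.elim0, s)))

/-- The expected discounted payoff of the strategy `σ` from the initial state `s`. -/
noncomputable def payoff (M : DiscountedDP S A) (σ : M.Strategy) (s : S) : ℝ :=
  ∫ ω, ∑' t : ℕ, M.β ^ t * M.r (ω t) ∂(M.pathLaw σ s)

/-- The value function: the supremum of the expected discounted payoff over all strategies. -/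
noncomputable def value (M : DiscountedDP S A) (s : S) : ℝ :=
  ⨆ σ : M.Strategy, M.payoff σ s

/-- `Q(s, a, f) = r(s, a) + β ∫ f(s') p(s, a, ds')`. -/
noncomputable def Q (M : DiscountedDP S A) (s : S) (a : A) (f : S → ℝ) : ℝ :=
  M.r (s, a) + M.β * ∫ s', f s' ∂(M.p (s, a))

/-- The optimal policy correspondence
`G(s) = argmax_{a ∈ Γ(s)} r(s, a) + β ∫ V(s') p(s, a, ds')`, with `V` the value function. -/
def optimalActions (M : DiscountedDP S A) (s : S) : Set A :=
  {a | a ∈ M.Γ s ∧ ∀ b ∈ M.Γ s, M.Q s b M.value ≤ M.Q s a M.value}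

end Strategies

/-- The transition probability function `p` is upper semi-continuous: it maps bounded upper
semi-continuous functions to bounded upper semi-continuous functions. -/
def IsUSCTransition {S A : Type*} [MeasurableSpace S] [MeasurableSpace A]
    [TopologicalSpace S] [TopologicalSpace A] (p : ProbabilityTheory.Kernel (S × A) S) : Prop :=
  ∀ f : S → ℝ, UpperSemicontinuous f → (∃ C, ∀ s, |f s| ≤ C) →
    UpperSemicontinuous (fun x : S × A => ∫ s', f s' ∂(p x)) ∧
      ∃ C, ∀ x : S × A, |∫ s', f s' ∂(p x)| ≤ C

/-- The transition probability function `p` is supermodular: `(s, a) ↦ ∫ f(s') p(s, a, ds')` is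
supermodular whenever the bounded measurable function `f` is. -/
def IsSupermodularTransition {S A : Type*} [MeasurableSpace S] [MeasurableSpace A]
    [Lattice S] [Lattice A] (p : ProbabilityTheory.Kernel (S × A) S) : Prop :=
  ∀ f : S → ℝ, Measurable f → (∃ C, ∀ s, |f s| ≤ C) → IsSupermodular f →
    IsSupermodular (fun x : S × A => ∫ s', f s' ∂(p x))

/-- The standing assumptions of upper semi-continuous dynamic programming. -/
structure IsUSC {S A : Type*} [MeasurableSpace S] [MeasurableSpace A]
    [TopologicalSpace S] [TopologicalSpace A] (M : DiscountedDP S A) : Prop where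
  bounded_r : ∃ C, ∀ x, |M.r x| ≤ C
  usc_r : UpperSemicontinuous M.r
  usc_p : IsUSCTransition M.p
  usc_Γ : UpperHemicontinuous M.Γ
  nonempty_Γ : ∀ s, (M.Γ s).Nonempty
  compact_Γ : ∀ s, IsCompact (M.Γ s)

end DiscountedDP

open MeasureTheory ProbabilityTheory Filter Topology

/-! The Bellman operator preserves bounded upper semi-continuous supermodular functions:
semi-continuity survives by compactness and hemicontinuity
(`UpperHemicontinuous.isClosed_setOf_exists_mem`), supermodularity because joins and meets of
maximizers stay feasible (`IsSupermodular.of_isGreatest`). It contracts sup-distances by `β`, so its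
iterates from `0` converge uniformly to a fixed point `V` of the same kind
(`IsUSC.exists_bellman_eq_self`). Then `Q(·, ·, V)` is supermodular, and Topkis' argument
(`strongSetGE_argmax`) makes its argmax ascending.

It remains to identify `V` with the value function. By telescoping, `V s` minus the payoff of a
strategy is the discounted sum of its expected one-period losses (`hasSum_loss`); these are
nonnegative for every strategy and vanish for a stationary one that always maximizes. A measurable
maximizer exists because each argmax is compact and closed under joins: its greatest element is a
measurable selector (`exists_measurable_selector`). -/

/-! ### Semi-continuity, supermodularity and compact sublattices -/

/-- The projection of a closed set along an upper hemicontinuous compact-valued correspondence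
is closed. -/
theorem UpperHemicontinuous.isClosed_setOf_exists_mem {X Y : Type*} [TopologicalSpace X]
    [TopologicalSpace Y] {Γ : X → Set Y} (hΓ : UpperHemicontinuous Γ)
    (hc : ∀ x, IsCompact (Γ x)) {C : Set (X × Y)} (hC : IsClosed C) :
    IsClosed {x | ∃ y ∈ Γ x, (x, y) ∈ C} := by
  rw [← isOpen_compl_iff, isOpen_iff_mem_nhds]
  intro x hx
  have hsub : ({x} : Set X) ×ˢ Γ x ⊆ Cᶜ := by
    rintro ⟨x', y⟩ ⟨rfl, hy⟩ hxy
    exact hx ⟨y, hy, hxy⟩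
  obtain ⟨u, v, hu, hv, hxu, hΓv, huv⟩ :=
    generalized_tube_lemma isCompact_singleton (hc x) hC.isOpen_compl hsub
  filter_upwards [hu.mem_nhds (hxu rfl),
    upperHemicontinuous_iff_forall_isOpen.1 hΓ x v hv hΓv] with x' hx' hΓx'
  rintro ⟨y, hy, hxy⟩
  exact huv (Set.mk_mem_prod hx' (hΓx' hy)) hxy

theorem upperSemicontinuous_of_uniform_approx {X : Type*} [TopologicalSpace X] {f : X → ℝ}
    {F : ℕ → X → ℝ} {ε : ℕ → ℝ} (hF : ∀ n, UpperSemicontinuous (F n))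
    (hε : Tendsto ε atTop (𝓝 0)) (h : ∀ n x, |F n x - f x| ≤ ε n) : UpperSemicontinuous f := by
  refine upperSemicontinuous_iff.2 fun x => upperSemicontinuousAt_iff.2 fun y hy => ?_
  obtain ⟨n, hn⟩ := (hε.eventually (gt_mem_nhds (show (0 : ℝ) < (y - f x) / 2 by linarith))).exists
  have hx := abs_le.1 (h n x)
  filter_upwards [upperSemicontinuousAt_iff.1 (upperSemicontinuous_iff.1 (hF n) x) (y - ε n)
    (by linarith)] with x' hx'
  have := abs_le.1 (h n x')
  linarith

theorem IsSupermodular.of_tendsto {X : Type*} [Lattice X] {f : X → ℝ} {F : ℕ → X → ℝ}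
    (hF : ∀ n, IsSupermodular (F n)) (h : ∀ x, Tendsto (fun n => F n x) atTop (𝓝 (f x))) :
    IsSupermodular f := fun x y =>
  le_of_tendsto_of_tendsto' ((h x).add (h y)) ((h _).add (h _)) fun n => hF n x y

/-- The supremum of a supermodular function over a supermodular correspondence is supermodular,
if it is attained. -/
theorem IsSupermodular.of_isGreatest {X Y : Type*} [Lattice X] [Lattice Y] {Γ : X → Set Y}
    (hΓ : IsSupermodularCorr Γ) {q : X × Y → ℝ} (hq : IsSupermodular q) {v : X → ℝ}
    (hv : ∀ x, IsGreatest ((fun y => q (x, y)) '' Γ x) (v x)) : IsSupermodular v := by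
  intro x x'
  obtain ⟨y, hy, hxy⟩ := (hv x).1
  obtain ⟨y', hy', hxy'⟩ := (hv x').1
  obtain ⟨hsup, hinf⟩ := hΓ x x' y y' hy hy'
  have h₁ := (hv (x ⊔ x')).2 (Set.mem_image_of_mem _ hsup)
  have h₂ := (hv (x ⊓ x')).2 (Set.mem_image_of_mem _ hinf)
  have h₃ := hq (x, y) (x', y')
  rw [Prod.mk_sup_mk, Prod.mk_inf_mk] at h₃
  simp only at hxy hxy' h₁ h₂
  linarith

/-- The maximizers of a supermodular function over a supermodular correspondence increase in the
strong set order. -/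
theorem strongSetGE_argmax {X Y : Type*} [Lattice X] [Lattice Y] {Γ : X → Set Y}
    (hΓ : IsSupermodularCorr Γ) {q : X × Y → ℝ} (hq : IsSupermodular q) {x₁ x₂ : X}
    (hx : x₁ ≤ x₂) :
    StrongSetGE {y | y ∈ Γ x₂ ∧ ∀ z ∈ Γ x₂, q (x₂, z) ≤ q (x₂, y)}
      {y | y ∈ Γ x₁ ∧ ∀ z ∈ Γ x₁, q (x₁, z) ≤ q (x₁, y)} := by
  rintro y₂ ⟨hy₂, hmax₂⟩ y₁ ⟨hy₁, hmax₁⟩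
  obtain ⟨hsup, hinf⟩ := hΓ x₂ x₁ y₂ y₁ hy₂ hy₁
  have h := hq (x₂, y₂) (x₁, y₁)
  rw [Prod.mk_sup_mk, Prod.mk_inf_mk] at h
  rw [sup_eq_left.2 hx] at hsup h
  rw [inf_eq_right.2 hx] at hinf h
  have h₁ := hmax₁ _ hinf
  have h₂ := hmax₂ _ hsup
  exact ⟨⟨hsup, fun z hz => (hmax₂ z hz).trans (by linarith)⟩,
    ⟨hinf, fun z hz => (hmax₁ z hz).trans (by linarith)⟩⟩

/-- A nonempty compact set closed under joins in a sublattice of `ℝᵏ` has a greatest element. -/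
theorem exists_isGreatest_of_isCompact_supClosed {k : ℕ} {A : Sublattice (Fin k → ℝ)} {K : Set A}
    (hne : K.Nonempty) (hK : IsCompact K) (hsup : SupClosed K) : ∃ a, IsGreatest K a := by
  -- The coordinate sum is continuous and strictly increasing, so its maximizer cannot be enlarged
  -- by a join.
  obtain ⟨a, ha, hmax⟩ := hK.exists_isMaxOn hne
    (f := fun a : A => ∑ i, (a : Fin k → ℝ) i) (by fun_prop)
  refine ⟨a, ha, fun b hb i => ?_⟩
  by_contra! hlt
  have h : ∑ i, (a : Fin k → ℝ) i < ∑ i, ((a ⊔ b : A) : Fin k → ℝ) i :=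
    Finset.sum_lt_sum (fun j _ => le_sup_left) ⟨i, Finset.mem_univ i, lt_sup_iff.2 (.inr hlt)⟩
  exact h.not_ge (hmax (hsup ha hb))

/-! ### The Bellman operator and its fixed point -/

namespace DiscountedDP

section Bellman

variable {S A : Type*} [MeasurableSpace S] [MeasurableSpace A] (M : DiscountedDP S A)

/-- The Bellman operator. -/
noncomputable def bellman (f : S → ℝ) (s : S) : ℝ :=
  sSup ((fun a => M.Q s a f) '' M.Γ s)

variable {M}

theorem abs_Q_le {C D : ℝ} (hC : ∀ x, |M.r x| ≤ C) {f : S → ℝ} (hD : ∀ s, |f s| ≤ D) (s : S)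
    (a : A) : |M.Q s a f| ≤ C + M.β * D := by
  have h : |∫ s', f s' ∂(M.p (s, a))| ≤ D := by
    simpa using norm_integral_le_of_norm_le_const (μ := M.p (s, a))
      (Eventually.of_forall fun s' => (Real.norm_eq_abs _).trans_le (hD s'))
  calc |M.Q s a f| ≤ |M.r (s, a)| + |M.β * ∫ s', f s' ∂(M.p (s, a))| := abs_add_le _ _
    _ ≤ C + M.β * D := by
      rw [abs_mul, abs_of_pos M.β_pos]
      exact add_le_add (hC _) (mul_le_mul_of_nonneg_left h M.β_pos.le)

theorem integrable_of_measurable_of_abs_le {X : Type*} [MeasurableSpace X] {μ : Measure X}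
    [IsFiniteMeasure μ] {f : X → ℝ} (hf : Measurable f) (hb : ∃ C, ∀ x, |f x| ≤ C) :
    Integrable f μ :=
  hb.elim fun C hC => Integrable.of_bound hf.aestronglyMeasurable C (.of_forall hC)

theorem abs_Q_sub_le {f g : S → ℝ} (hf : Measurable f) (hfb : ∃ C, ∀ s, |f s| ≤ C)
    (hg : Measurable g) (hgb : ∃ C, ∀ s, |g s| ≤ C) {D : ℝ} (hD : ∀ s, |f s - g s| ≤ D)
    (s : S) (a : A) : |M.Q s a f - M.Q s a g| ≤ M.β * D := by
  have h : |∫ s', (f s' - g s') ∂(M.p (s, a))| ≤ D := by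
    simpa using norm_integral_le_of_norm_le_const (μ := M.p (s, a))
      (Eventually.of_forall fun s' => (Real.norm_eq_abs _).trans_le (hD s'))
  rw [integral_sub (integrable_of_measurable_of_abs_le hf hfb)
    (integrable_of_measurable_of_abs_le hg hgb)] at h
  rw [Q, Q, add_sub_add_left_eq_sub, ← mul_sub, abs_mul, abs_of_pos M.β_pos]
  exact mul_le_mul_of_nonneg_left h M.β_pos.le

theorem isSupermodular_Q [Lattice S] [Lattice A] (hr : IsSupermodular M.r)
    (hp : IsSupermodularTransition M.p) {f : S → ℝ} (hf : Measurable f)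
    (hb : ∃ C, ∀ s, |f s| ≤ C) (hfs : IsSupermodular f) :
    IsSupermodular fun x : S × A => M.Q x.1 x.2 f := by
  intro x y
  have h₁ := hr x y
  have h₂ := mul_le_mul_of_nonneg_left (hp f hf hb hfs x y) M.β_pos.le
  simp only [Q]
  linarith

variable [TopologicalSpace S] [TopologicalSpace A]

theorem IsUSC.upperSemicontinuous_Q (hM : M.IsUSC) {f : S → ℝ} (hf : UpperSemicontinuous f)
    (hb : ∃ C, ∀ s, |f s| ≤ C) : UpperSemicontinuous fun x : S × A => M.Q x.1 x.2 f :=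
  hM.usc_r.add ((continuous_const_mul M.β).comp_upperSemicontinuous (hM.usc_p f hf hb).1
    (monotone_mul_left_of_nonneg M.β_pos.le))

theorem IsUSC.isGreatest_bellman (hM : M.IsUSC) {f : S → ℝ} (hf : UpperSemicontinuous f)
    (hb : ∃ C, ∀ s, |f s| ≤ C) (s : S) :
    IsGreatest ((fun a => M.Q s a f) '' M.Γ s) (M.bellman f s) := by
  have husc : UpperSemicontinuous fun a => M.Q s a f :=
    (hM.upperSemicontinuous_Q hf hb).comp (Continuous.prodMk_right s)
  obtain ⟨a, ha, hmax⟩ := (husc.upperSemicontinuousOn _).exists_isMaxOn (hM.nonempty_Γ s)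
    (hM.compact_Γ s)
  have h : IsGreatest ((fun a => M.Q s a f) '' M.Γ s) (M.Q s a f) :=
    ⟨Set.mem_image_of_mem _ ha, Set.forall_mem_image.2 hmax⟩
  rwa [bellman, h.csSup_eq]

/-- Since the supremum is attained, each superlevel set is the projection along `Γ` of a closed
superlevel set of `Q`. -/
theorem IsUSC.upperSemicontinuous_bellman (hM : M.IsUSC) {f : S → ℝ}
    (hf : UpperSemicontinuous f) (hb : ∃ C, ∀ s, |f s| ≤ C) :
    UpperSemicontinuous (M.bellman f) := by
  refine upperSemicontinuous_iff_isClosed_preimage.2 fun y => ?_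
  have h := hM.usc_Γ.isClosed_setOf_exists_mem hM.compact_Γ
    ((hM.upperSemicontinuous_Q hf hb).isClosed_preimage y)
  convert h using 1
  ext s
  have hs := hM.isGreatest_bellman hf hb s
  constructor
  · intro hy
    obtain ⟨a, ha, hQ⟩ := hs.1
    exact ⟨a, ha, hy.trans hQ.ge⟩
  · rintro ⟨a, ha, hQ⟩
    exact le_trans hQ (hs.2 (Set.mem_image_of_mem _ ha))

theorem IsUSC.abs_bellman_le (hM : M.IsUSC) {C D : ℝ} (hC : ∀ x, |M.r x| ≤ C) {f : S → ℝ}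
    (hf : UpperSemicontinuous f) (hD : ∀ s, |f s| ≤ D) (s : S) :
    |M.bellman f s| ≤ C + M.β * D := by
  obtain ⟨a, -, hQ⟩ := (hM.isGreatest_bellman hf ⟨D, hD⟩ s).1
  exact hQ ▸ abs_Q_le hC hD s a

/-- A maximizer for either function is feasible for the other, so the two maxima differ by at most
the uniform gap between the `Q`'s. -/
theorem IsUSC.abs_bellman_sub_le [OpensMeasurableSpace S] (hM : M.IsUSC) {f g : S → ℝ}
    (hf : UpperSemicontinuous f) (hfb : ∃ C, ∀ s, |f s| ≤ C)
    (hg : UpperSemicontinuous g) (hgb : ∃ C, ∀ s, |g s| ≤ C) {D : ℝ}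
    (hD : ∀ s, |f s - g s| ≤ D) (s : S) :
    |M.bellman f s - M.bellman g s| ≤ M.β * D := by
  have hQ := fun a => abs_le.1 (abs_Q_sub_le (M := M) hf.measurable hfb hg.measurable hgb hD s a)
  have hF := hM.isGreatest_bellman hf hfb s
  have hG := hM.isGreatest_bellman hg hgb s
  obtain ⟨a, ha, haf⟩ := hF.1
  obtain ⟨b, hb, hbg⟩ := hG.1
  have h₁ := hG.2 (Set.mem_image_of_mem _ ha)
  have h₂ := hF.2 (Set.mem_image_of_mem _ hb)
  have h₃ := hQ a
  have h₄ := hQ b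
  simp only at haf hbg h₁ h₂
  exact abs_le.2 ⟨by linarith, by linarith⟩

/-- The Bellman operator has a bounded upper semi-continuous supermodular fixed point. -/
theorem IsUSC.exists_bellman_eq_self [OpensMeasurableSpace S] [Lattice S] [Lattice A]
    (hM : M.IsUSC) (hr : IsSupermodular M.r) (hp : IsSupermodularTransition M.p)
    (hΓ : IsSupermodularCorr M.Γ) :
    ∃ V : S → ℝ, UpperSemicontinuous V ∧ (∃ C, ∀ s, |V s| ≤ C) ∧ IsSupermodular V ∧
      M.bellman V = V := by
  obtain ⟨C, hC⟩ := hM.bounded_r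
  have hβ := M.β_pos
  have hβ' := M.β_lt_one
  let F : ℕ → S → ℝ := fun n => (M.bellman)^[n] 0
  have hFs : ∀ n, F (n + 1) = M.bellman (F n) := fun n => Function.iterate_succ_apply' _ _ _
  have hF : ∀ n, UpperSemicontinuous (F n) ∧ (∃ D, ∀ s, |F n s| ≤ D) ∧ IsSupermodular (F n) := by
    intro n
    induction n with
    | zero =>
      exact ⟨upperSemicontinuous_const, ⟨0, fun s => by simp [F]⟩, fun x y => by simp [F]⟩
    | succ n ih =>
      obtain ⟨husc, ⟨D, hD⟩, hsm⟩ := ih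
      rw [hFs]
      exact ⟨hM.upperSemicontinuous_bellman husc ⟨D, hD⟩, ⟨_, hM.abs_bellman_le hC husc hD⟩,
        .of_isGreatest hΓ (isSupermodular_Q hr hp husc.measurable ⟨D, hD⟩ hsm)
          (hM.isGreatest_bellman husc ⟨D, hD⟩)⟩
  have hstep : ∀ s n, dist (F n s) (F (n + 1) s) ≤ C * M.β ^ n := by
    intro s n
    rw [dist_comm, Real.dist_eq]
    induction n generalizing s with
    | zero =>
      have := hM.abs_bellman_le hC (hF 0).1 (D := 0) (by simp [F]) s
      simpa [hFs, F] using this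
    | succ n ih =>
      rw [hFs (n + 1)]
      nth_rw 2 [hFs n]
      refine (hM.abs_bellman_sub_le (hF _).1 (hF _).2.1 (hF _).1 (hF _).2.1 ih s).trans_eq ?_
      ring
  choose V hV using fun s =>
    cauchySeq_tendsto_of_complete (cauchySeq_of_le_geometric M.β C hβ' (hstep s))
  have hunif : ∀ n s, |F n s - V s| ≤ C * M.β ^ n / (1 - M.β) := fun n s =>
    dist_le_of_le_geometric_of_tendsto M.β C hβ' (hstep s) (hV s) n
  have hε : Tendsto (fun n => C * M.β ^ n / (1 - M.β)) atTop (𝓝 0) := by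
    simpa using ((tendsto_pow_atTop_nhds_zero_of_lt_one hβ.le hβ').const_mul C).div_const (1 - M.β)
  have husc : UpperSemicontinuous V :=
    upperSemicontinuous_of_uniform_approx (fun n => (hF n).1) hε hunif
  have hb : ∃ D, ∀ s, |V s| ≤ D :=
    ⟨_, fun s => by simpa [F] using hunif 0 s⟩
  refine ⟨V, husc, hb, .of_tendsto (fun n => (hF n).2.2) hV, funext fun s => ?_⟩
  -- The shifted iterates tend to `V s`, and by contraction also to `M.bellman V s`.
  refine tendsto_nhds_unique (tendsto_iff_dist_tendsto_zero.2 ?_)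
    ((hV s).comp (tendsto_add_atTop_nat 1))
  refine squeeze_zero (fun _ => dist_nonneg) (fun n => ?_) (by simpa using hε.const_mul M.β)
  rw [Function.comp_apply, hFs, Real.dist_eq]
  exact hM.abs_bellman_sub_le (hF n).1 (hF n).2.1 husc hb (hunif n) s

end Bellman

end DiscountedDP

/-! ### Path laws and verification of the fixed point -/

namespace DiscountedDP

section PathLaw

variable {S A : Type*} [MeasurableSpace S] [MeasurableSpace A] {M : DiscountedDP S A}

instance (σ : M.Strategy) (s : S) : IsProbabilityMeasure (M.pathLaw σ s) := by
  unfold pathLaw; infer_instance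

theorem compProd_stepKernel (σ : M.Strategy) (s : S) (t : ℕ) :
    Kernel.partialTraj (X := fun _ => S × A) (M.stepKernel σ) 0 t
        (fun _ => (s, σ.act 0 (Fin.elim0, s))) ⊗ₘ M.stepKernel σ t =
      (M.pathLaw σ s).map (fun ω => (Preorder.frestrictLe t ω, ω (t + 1))) :=
  Kernel.partialTraj_compProd_eq_map_traj (Nat.zero_le t)

theorem map_eval_zero_pathLaw (σ : M.Strategy) (s : S) :
    (M.pathLaw σ s).map (fun ω => ω 0) = Measure.dirac (s, σ.act 0 (Fin.elim0, s)) := by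
  have h := Kernel.traj_map_frestrictLe_apply (X := fun _ => S × A) (κ := M.stepKernel σ) 0 0
    (fun _ => (s, σ.act 0 (Fin.elim0, s)))
  rw [Kernel.partialTraj_self, Kernel.id_apply] at h
  have hm : Measurable fun x : Finset.Iic 0 → S × A => x ⟨0, by simp⟩ := measurable_pi_apply _
  calc (M.pathLaw σ s).map (fun ω => ω 0)
      = ((M.pathLaw σ s).map (Preorder.frestrictLe 0)).map
          fun x : Finset.Iic 0 → S × A => x ⟨0, by simp⟩ :=
        (Measure.map_map (f := Preorder.frestrictLe (π := fun _ => S × A) 0) hm (by fun_prop)).symm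
    _ = _ := (congrArg _ h).trans (Measure.map_dirac' hm _)

/-- A measurable property of state-action pairs that the strategy guarantees at every history holds
almost surely in every period. -/
theorem ae_pathLaw_mem (σ : M.Strategy) (s : S) {B : Set (S × A)} (hB : MeasurableSet B)
    (h : ∀ t (y : History S A t), (y.2, σ.act t y) ∈ B) (t : ℕ) :
    ∀ᵐ ω ∂(M.pathLaw σ s), ω t ∈ B := by
  cases t with
  | zero =>
    have key : ∀ᵐ x ∂((M.pathLaw σ s).map (fun ω => ω 0)), x ∈ B := by
      rw [map_eval_zero_pathLaw]
      exact (ae_dirac_iff hB).2 (h 0 (Fin.elim0, s))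
    exact ae_of_ae_map (measurable_pi_apply 0).aemeasurable key
  | succ t =>
    have hB' : MeasurableSet {x : (Finset.Iic t → S × A) × (S × A) | x.2 ∈ B} :=
      measurable_snd hB
    have key : ∀ᵐ x ∂((M.pathLaw σ s).map
        (fun ω => (Preorder.frestrictLe t ω, ω (t + 1)))), x.2 ∈ B := by
      rw [← compProd_stepKernel, Measure.ae_compProd_iff hB']
      refine .of_forall fun y => ?_
      rw [stepKernel, Kernel.map_apply _ (M.measurable_step σ t)]
      exact (ae_map_iff (M.measurable_step σ t).aemeasurable hB).2
        (.of_forall fun z => h (t + 1) (nextHistory t z))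
    exact (ae_map_iff (by fun_prop) hB').1 key

/-- The state marginal of `stepKernel` is `p` at the last state-action pair, whatever action the
strategy then takes. -/
theorem integral_state_succ (σ : M.Strategy) (s : S) {f : S → ℝ} (hf : Measurable f)
    (hb : ∃ C, ∀ s, |f s| ≤ C) (t : ℕ) :
    ∫ ω, f (ω (t + 1)).1 ∂(M.pathLaw σ s) =
      ∫ ω, (∫ s', f s' ∂(M.p (ω t))) ∂(M.pathLaw σ s) := by
  have hm : Measurable fun ω : ℕ → S × A =>
      (Preorder.frestrictLe (π := fun _ => S × A) t ω, ω (t + 1)) := by fun_prop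
  have hg : Measurable fun x : (Finset.Iic t → S × A) × (S × A) => f x.2.1 := by fun_prop
  have hstep : ∀ h, ∫ x, f x.1 ∂(M.stepKernel σ t h) =
      ∫ s', f s' ∂(M.p (h ⟨t, Finset.mem_Iic.2 le_rfl⟩)) := by
    intro h
    have hm' := M.measurable_step σ t
    rw [stepKernel, Kernel.map_apply _ hm', integral_map hm'.aemeasurable
      (f := fun x : S × A => f x.1) (hf.comp measurable_fst).aestronglyMeasurable]
    have := integral_map (μ := ((Kernel.id ×ₖ (M.p.comap (fun h : Finset.Iic t → S × A =>
      h ⟨t, Finset.mem_Iic.2 le_rfl⟩) (measurable_pi_apply _))) h)) (φ := Prod.snd) (f := f)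
      measurable_snd.aemeasurable hf.aestronglyMeasurable
    rw [← this, ← Kernel.map_apply _ measurable_snd, ← Kernel.snd_eq, Kernel.snd_prod,
      Kernel.comap_apply]
  have h₁ := integral_map (μ := M.pathLaw σ s) hm.aemeasurable hg.aestronglyMeasurable
  rw [← compProd_stepKernel, Measure.integral_compProd
    (integrable_of_measurable_of_abs_le hg (hb.imp fun C hC x => hC _))] at h₁
  rw [← h₁]
  simp only [hstep]
  rw [← Kernel.traj_map_frestrictLe_apply, integral_map (by fun_prop)]
  · rfl
  · exact ((hf.stronglyMeasurable.integral_kernel (κ := M.p)).comp_measurable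
      (measurable_pi_apply _)).aestronglyMeasurable

theorem measurable_Q {f : S → ℝ} (hf : Measurable f) :
    Measurable fun x : S × A => M.Q x.1 x.2 f :=
  M.measurable_r.add
    ((hf.stronglyMeasurable.integral_kernel (κ := M.p)).measurable.const_mul M.β)

theorem hasSum_payoff (hr : ∃ C, ∀ x, |M.r x| ≤ C) (σ : M.Strategy) (s : S) :
    HasSum (fun t => M.β ^ t * ∫ ω, M.r (ω t) ∂(M.pathLaw σ s)) (M.payoff σ s) := by
  obtain ⟨C, hC⟩ := hr
  have hβ := M.β_pos
  have hm : ∀ t, Measurable fun ω : ℕ → S × A => M.β ^ t * M.r (ω t) := fun t =>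
    (M.measurable_r.comp (measurable_pi_apply t)).const_mul _
  have hbd : ∀ t (ω : ℕ → S × A), |M.β ^ t * M.r (ω t)| ≤ M.β ^ t * C := fun t ω => by
    rw [abs_mul, abs_of_pos (pow_pos hβ t)]
    exact mul_le_mul_of_nonneg_left (hC _) (pow_pos hβ t).le
  have h := hasSum_integral_of_summable_integral_norm (μ := M.pathLaw σ s)
    (F := fun t (ω : ℕ → S × A) => M.β ^ t * M.r (ω t))
    (fun t => integrable_of_measurable_of_abs_le (hm t) ⟨_, hbd t⟩) ?_
  · simp only [integral_const_mul] at h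
    exact h
  · refine Summable.of_nonneg_of_le (fun t => integral_nonneg fun ω => norm_nonneg _) (fun t => ?_)
      ((summable_geometric_of_lt_one hβ.le M.β_lt_one).mul_right C)
    have := norm_integral_le_of_norm_le_const (μ := M.pathLaw σ s)
      (f := fun ω : ℕ → S × A => ‖M.β ^ t * M.r (ω t)‖) (C := M.β ^ t * C)
      (.of_forall fun ω => (norm_norm _).trans_le (hbd t ω))
    simpa using (le_abs_self _).trans this

/-- The expected payoff, corrected by the expected one-period losses relative to `V`. -/
theorem hasSum_loss (hr : ∃ C, ∀ x, |M.r x| ≤ C) {V : S → ℝ} (hV : Measurable V)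
    (hb : ∃ C, ∀ s, |V s| ≤ C) (σ : M.Strategy) (s : S) :
    HasSum (fun t => M.β ^ t *
        ∫ ω, (V (ω t).1 - M.Q (ω t).1 (ω t).2 V) ∂(M.pathLaw σ s)) (V s - M.payoff σ s) := by
  obtain ⟨D, hD⟩ := hb
  have hβ := M.β_pos
  set R : ℕ → ℝ := fun t => ∫ ω, M.r (ω t) ∂(M.pathLaw σ s)
  set E : ℕ → ℝ := fun t => ∫ ω, V (ω t).1 ∂(M.pathLaw σ s) with hE
  have hE0 : E 0 = V s := by
    have h := integral_map (μ := M.pathLaw σ s) (φ := fun ω : ℕ → S × A => ω 0)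
      (f := fun x : S × A => V x.1) (measurable_pi_apply 0).aemeasurable
      (hV.comp measurable_fst).aestronglyMeasurable
    rw [map_eval_zero_pathLaw] at h
    exact h.symm.trans (integral_dirac' _ _ (hV.comp measurable_fst).stronglyMeasurable)
  have hEb : ∀ t, |E t| ≤ D := fun t => by
    simpa using norm_integral_le_of_norm_le_const (μ := M.pathLaw σ s)
      (f := fun ω : ℕ → S × A => V (ω t).1) (.of_forall fun ω => hD _)
  have hP : Measurable fun x : S × A => ∫ s', V s' ∂(M.p x) :=
    (hV.stronglyMeasurable.integral_kernel (κ := M.p)).measurable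
  have hPb : ∃ C, ∀ x : S × A, |∫ s', V s' ∂(M.p x)| ≤ C := ⟨D, fun x => by
    simpa using norm_integral_le_of_norm_le_const (μ := M.p x) (f := V) (.of_forall hD)⟩
  -- After discounting, the `E` terms telescope and the `R` terms sum to the payoff.
  have hterm : ∀ t, ∫ ω, (V (ω t).1 - M.Q (ω t).1 (ω t).2 V) ∂(M.pathLaw σ s) =
      E t - R t - M.β * E (t + 1) := by
    intro t
    have i₁ : Integrable (fun ω => V (ω t).1) (M.pathLaw σ s) :=
      integrable_of_measurable_of_abs_le (by fun_prop) ⟨D, fun ω => hD _⟩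
    have i₂ : Integrable (fun ω => M.r (ω t)) (M.pathLaw σ s) :=
      integrable_of_measurable_of_abs_le (M.measurable_r.comp (measurable_pi_apply t))
        (hr.imp fun C hC ω => hC _)
    have i₃ : Integrable (fun ω => M.β * ∫ s', V s' ∂(M.p (ω t))) (M.pathLaw σ s) :=
      (integrable_of_measurable_of_abs_le (hP.comp (measurable_pi_apply t))
        (hPb.imp fun C hC ω => hC _)).const_mul _
    simp only [Q, Prod.mk.eta, hE]
    have h₁ := integral_sub i₁ (i₂.add i₃)
    have h₂ := integral_add i₂ i₃
    rw [integral_const_mul] at h₂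
    rw [integral_state_succ σ s hV ⟨D, hD⟩, sub_sub, ← h₂]
    exact h₁
  have hlim : Tendsto (fun t => M.β ^ t * E t) atTop (𝓝 0) := by
    refine squeeze_zero_norm (a := fun t => M.β ^ t * D) (fun t => ?_) ?_
    · rw [norm_mul, Real.norm_of_nonneg (pow_pos hβ t).le]
      exact mul_le_mul_of_nonneg_left (hEb t) (pow_pos hβ t).le
    · simpa using (tendsto_pow_atTop_nhds_zero_of_lt_one hβ.le M.β_lt_one).mul_const D
  have htel : HasSum (fun t => M.β ^ t * E t - M.β ^ (t + 1) * E (t + 1)) (V s) := by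
    have hsum : Summable fun t => M.β ^ t * E t :=
      Summable.of_norm_bounded
        ((summable_geometric_of_lt_one hβ.le M.β_lt_one).mul_right D) fun t => by
          rw [norm_mul, Real.norm_of_nonneg (pow_pos hβ t).le]
          exact mul_le_mul_of_nonneg_left (hEb t) (pow_pos hβ t).le
    refine (hsum.sub ((summable_nat_add_iff 1).2 hsum)).hasSum_iff_tendsto_nat.2 ?_
    simp only [Finset.sum_range_sub' (fun t => M.β ^ t * E t)]
    simpa [hE0] using hlim.const_sub (V s)
  have hsum := htel.sub (hasSum_payoff hr σ s)
  have hfun : (fun t => M.β ^ t * E t - M.β ^ (t + 1) * E (t + 1) - M.β ^ t * R t) =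
      fun t => M.β ^ t * ∫ ω, (V (ω t).1 - M.Q (ω t).1 (ω t).2 V) ∂(M.pathLaw σ s) := by
    funext t
    rw [hterm]
    ring
  exact hfun ▸ hsum

theorem payoff_le (hr : ∃ C, ∀ x, |M.r x| ≤ C) {V : S → ℝ} (hV : Measurable V)
    (hb : ∃ C, ∀ s, |V s| ≤ C) (h : ∀ s, ∀ a ∈ M.Γ s, M.Q s a V ≤ V s) (σ : M.Strategy) (s : S) :
    M.payoff σ s ≤ V s := by
  refine sub_nonneg.1 ((hasSum_loss hr hV hb σ s).nonneg fun t =>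
    mul_nonneg (pow_pos M.β_pos t).le (integral_nonneg_of_ae ?_))
  -- Feasibility enters through this measurable set, so measurability of the graph of `Γ` is not
  -- needed.
  filter_upwards [ae_pathLaw_mem σ s (B := {x | M.Q x.1 x.2 V ≤ V x.1})
    (measurableSet_le (measurable_Q hV) (hV.comp measurable_fst))
    (fun t y => h _ _ (σ.feasible t y)) t] with ω hω
  exact sub_nonneg.2 hω

theorem payoff_eq (hr : ∃ C, ∀ x, |M.r x| ≤ C) {V : S → ℝ} (hV : Measurable V)
    (hb : ∃ C, ∀ s, |V s| ≤ C) (σ : M.Strategy)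
    (h : ∀ t (y : History S A t), M.Q y.2 (σ.act t y) V = V y.2) (s : S) :
    M.payoff σ s = V s := by
  have hloss : ∀ t, M.β ^ t *
      ∫ ω, (V (ω t).1 - M.Q (ω t).1 (ω t).2 V) ∂(M.pathLaw σ s) = 0 := by
    intro t
    rw [integral_eq_zero_of_ae, mul_zero]
    filter_upwards [ae_pathLaw_mem σ s (B := {x | M.Q x.1 x.2 V = V x.1})
      (measurableSet_eq_fun (measurable_Q hV) (hV.comp measurable_fst)) h t] with ω hω
    exact sub_eq_zero.2 (Eq.symm hω)
  have hsum := hasSum_loss hr hV hb σ s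
  simp only [hloss] at hsum
  exact (sub_eq_zero.1 (hsum.unique hasSum_zero)).symm

/-- A bounded fixed point of the Bellman operator that a measurable selector attains is the value
function. -/
theorem value_eq_of_selector (hr : ∃ C, ∀ x, |M.r x| ≤ C) {V : S → ℝ} (hV : Measurable V)
    (hb : ∃ C, ∀ s, |V s| ≤ C) (h : ∀ s, ∀ a ∈ M.Γ s, M.Q s a V ≤ V s) {g : S → A}
    (hg : Measurable g) (hgΓ : ∀ s, g s ∈ M.Γ s) (hgV : ∀ s, M.Q s (g s) V = V s) :
    M.value = V := by
  let σ : M.Strategy :=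
    { act := fun _ y => g y.2
      measurable_act := fun _ => hg.comp measurable_snd
      feasible := fun _ y => hgΓ y.2 }
  have : Nonempty M.Strategy := ⟨σ⟩
  funext s
  refine le_antisymm (ciSup_le fun τ => payoff_le hr hV hb h τ s) ?_
  rw [← payoff_eq hr hV hb σ (fun t y => hgV y.2) s]
  exact le_ciSup ⟨V s, Set.forall_mem_range.2 fun τ => payoff_le hr hV hb h τ s⟩ σ

end PathLaw
end DiscountedDP

/-! ### Measurable selection of maximizers -/

/-- A correspondence into a sublattice of `ℝᵏ` with nonempty compact values closed under joins has a
measurable selector, if its lower inverse images of closed sets are measurable. -/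
theorem exists_measurable_selector {X : Type*} [MeasurableSpace X] {k : ℕ}
    {A : Sublattice (Fin k → ℝ)} {G : X → Set A} (hne : ∀ x, (G x).Nonempty)
    (hc : ∀ x, IsCompact (G x)) (hsup : ∀ x, SupClosed (G x))
    (hmeas : ∀ F : Set A, IsClosed F → MeasurableSet {x | ∃ a ∈ G x, a ∈ F}) :
    ∃ g : X → A, Measurable g ∧ ∀ x, g x ∈ G x := by
  choose g hg using fun x => exists_isGreatest_of_isCompact_supClosed (hne x) (hc x) (hsup x)
  refine ⟨g, Measurable.subtype_mk (f := fun x => (g x : Fin k → ℝ)) (measurable_pi_iff.2 fun i =>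
    measurable_of_Ici fun c => ?_), fun x => (hg x).1⟩
  -- The greatest element has `i`-th coordinate at least `c` exactly when some element of `G x`
  -- does.
  convert hmeas {a | c ≤ (a : Fin k → ℝ) i}
    (isClosed_le continuous_const ((continuous_apply i).comp continuous_subtype_val)) using 1
  ext x
  exact ⟨fun h => ⟨g x, (hg x).1, h⟩, fun ⟨a, ha, hca⟩ => le_trans hca ((hg x).2 ha i)⟩

/-- As `v` is only measurable, its value is first replaced by a free real variable. The resulting
set in `X × ℝ` is closed, and it is pulled back along the measurable map `x ↦ (x, v x)`. -/
theorem UpperHemicontinuous.measurableSet_setOf_exists_mem_le {X Y : Type*} [TopologicalSpace X]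
    [TopologicalSpace Y] [MeasurableSpace X] [OpensMeasurableSpace X] [SecondCountableTopology X]
    {Γ : X → Set Y} (hΓ : UpperHemicontinuous Γ) (hc : ∀ x, IsCompact (Γ x)) {q : X × Y → ℝ}
    (hq : UpperSemicontinuous q) {v : X → ℝ} (hv : Measurable v) {F : Set Y} (hF : IsClosed F) :
    MeasurableSet {x | ∃ y ∈ Γ x, v x ≤ q (x, y) ∧ y ∈ F} := by
  have hC : IsClosed {z : (X × ℝ) × Y | z.1.2 ≤ q (z.1.1, z.2) ∧ z.2 ∈ F} :=
    ((upperSemicontinuous_iff_IsClosed_hypograph.1 hq).preimage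
      (f := fun z : (X × ℝ) × Y => ((z.1.1, z.2), z.1.2)) (by fun_prop)).inter
      (hF.preimage continuous_snd)
  have h := (hΓ.comp (g := (Prod.fst : X × ℝ → X)) continuous_fst).isClosed_setOf_exists_mem
    (fun z => hc z.1) hC
  exact (measurable_id.prodMk hv) h.measurableSet

/-! ### The main theorem -/

theorem mainTheorem7 (n k : ℕ)
    (S : Sublattice (Fin n → ℝ)) (A : Sublattice (Fin k → ℝ))
    (hS : MeasurableSet (S : Set (Fin n → ℝ))) (hA : MeasurableSet (A : Set (Fin k → ℝ)))
    (M : DiscountedDP S A) (hM : M.IsUSC)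
    (hr : IsSupermodular M.r)
    (hp : DiscountedDP.IsSupermodularTransition M.p)
    (hΓ : IsSupermodularCorr M.Γ) :
    IsAscending M.optimalActions := by
  obtain ⟨V, husc, hb, hsm, hfix⟩ := hM.exists_bellman_eq_self hr hp hΓ
  have hgr : ∀ s, IsGreatest ((fun a => M.Q s a V) '' M.Γ s) (V s) := fun s => by
    simpa only [hfix] using hM.isGreatest_bellman husc hb s
  have hQs := DiscountedDP.isSupermodular_Q hr hp husc.measurable hb hsm
  have hQu := hM.upperSemicontinuous_Q husc hb
  -- The argmax is taken relative to the fixed point `V`; it becomes `M.optimalActions` only once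
  -- `hvalue` is known.
  set G : S → Set A := fun s => {a | a ∈ M.Γ s ∧ ∀ b ∈ M.Γ s, M.Q s b V ≤ M.Q s a V} with hG
  have hGV : ∀ s a, a ∈ G s ↔ a ∈ M.Γ s ∧ V s ≤ M.Q s a V := by
    refine fun s a => and_congr_right fun _ => ⟨fun h => ?_, fun h b hb => ?_⟩
    · obtain ⟨b, hb, hbV⟩ := (hgr s).1
      exact hbV ▸ h b hb
    · exact ((hgr s).2 (Set.mem_image_of_mem _ hb)).trans h
  have hne : ∀ s, (G s).Nonempty := fun s =>
    let ⟨a, ha, haV⟩ := (hgr s).1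
    ⟨a, (hGV s a).2 ⟨ha, haV.ge⟩⟩
  have hstrong : ∀ s₁ s₂, s₁ ≤ s₂ → StrongSetGE (G s₂) (G s₁) := fun s₁ s₂ h =>
    strongSetGE_argmax hΓ hQs h
  have hcompact : ∀ s, IsCompact (G s) := by
    intro s
    have hcl : IsClosed {a | V s ≤ M.Q s a V} :=
      (hQu.comp (Continuous.prodMk_right s)).isClosed_preimage (V s)
    convert (hM.compact_Γ s).inter_right hcl using 1
    exact Set.ext (hGV s)
  -- Closure under joins is the strong set order at `s₁ = s₂`.
  obtain ⟨g, hg, hgG⟩ := exists_measurable_selector hne hcompact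
    (fun s a ha b hb => (hstrong s s le_rfl a ha b hb).1) fun F hF => by
      simpa only [hGV, and_assoc] using
        hM.usc_Γ.measurableSet_setOf_exists_mem_le hM.compact_Γ hQu husc.measurable hF
  have hvalue : M.value = V := by
    refine DiscountedDP.value_eq_of_selector hM.bounded_r husc.measurable hb
      (fun s a ha => (hgr s).2 (Set.mem_image_of_mem _ ha)) hg (fun s => (hgG s).1) fun s => ?_
    exact le_antisymm ((hgr s).2 (Set.mem_image_of_mem _ (hgG s).1)) ((hGV s _).1 (hgG s)).2
  have hopt : M.optimalActions = G := by
    simp only [hG, ← hvalue]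
    rfl
  rw [hopt]
  exact ⟨hne, fun s => ⟨fun a ha b hb => (hstrong s s le_rfl a ha b hb).1,
    fun a ha b hb => (hstrong s s le_rfl a ha b hb).2⟩, hstrong⟩
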